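/- There is a constant $c>0$, independent of the element (of its size, its angles and its aspect ratio), such that the following holds for $d\in\{2,3\}$. Let $T\subset\mathbb{R}^d$ be a nondegenerate closed $d$-simplex with vertices $p_1,\dots,p_{d+1}$ satisfying the following edge conditions. * $d=2$: $\overline{p_2p_3}$ is a longest edge of $T$ and $|p_1-p_3|\le |p_1-p_2|$. Set $e_1:=p_2-p_1$, $e_2:=p_3-p_1$. * $d=3$: let $L_{\min}$ be an edge of minimum length; $\overline{p_1p_2}$ is a longest one among the four edges sharing exactly one endpoint with $L_{\min}$; $p_4$ lies in the closed half-space containing $p_1$ bounded by the plane that bisects $\overline{p_1p_2}$ perpendicularly; and one of the following two cases holds. Type (i): $L_{\min}=\overline{p_1p_3}$ and $p_3$ lies in the closed half-space containing $p_1$; set $e_1:=p_2-p_1$, $e_2:=p_3-p_1$, $e_3:=p_4-p_1$. Type (ii): $L_{\min}=\overline{p_2p_3}$ and $p_3$ lies in the closed half-space containing $p_2$; set $e_1:=p_2-p_1$, $e_2:=p_3-p_2$, $e_3:=p_4-p_1$. Put $h_i:=|e_i|$, $r_i:=e_i/|e_i|$, $\partial\varphi/\partial r_i:=r_i\cdot\nabla\varphi$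 (weak derivative), and $\Pi_T^0\varphi:=\frac1{|T|}\int_T\varphi\,dx$. Then for every $\varphi\in H^1(T)$ $$\|\Pi_T^0\varphi-\varphi\|_{L^2(T)}\le c\sum_{i=1}^d h_i\left\|\frac{\partial\varphi}{\partial r_i}\right\|_{L^2(T)}.$$ In addition, let $\widehat T$ be the reference simplex with vertices, in this order, $(0,0),(1,0),(0,1)$ if $d=2$; $(0,0,0),(1,0,0),(0,1,0),(0,0,1)$ in type (i); $(0,0,0),(1,0,0),(1,1,0),(0,0,1)$ in type (ii); and let $\Phi$ be the affine bijection taking the vertices of $\widehat T$ to $p_1,\dots,p_{d+1}$ in order. If $\widehat\varphi\in H^1(\widehat T)$, then $\varphi:=\widehat\varphi\circ\Phi^{-1}$ belongs to $H^1(T)$ and satisfies the same estimate. -/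

import Mathlib

open MeasureTheory Set
open scoped ContDiff ENNReal

noncomputable section

namespace AnisoElement

/-- The Euclidean space `ℝᵈ`. -/
abbrev Space (d : ℕ) : Type := EuclideanSpace ℝ (Fin d)

/-- The closed simplex with vertices `p 0, …, p d`. -/
def simplex {d : ℕ} (p : Fin (d + 1) → Space d) : Set (Space d) :=
  convexHull ℝ (Set.range p)

/-- The kinds of elements: triangles for `d = 2`; tetrahedra of type (i) and of type (ii)
for `d = 3`. -/
inductive ElementKind : ℕ → Type
  | triangle : ElementKind 2
  | tetI : ElementKind 3
  | tetII : ElementKind 3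

/-- `a, b` are the endpoints of an edge of minimum length. -/
def IsMinEdge {d : ℕ} (p : Fin (d + 1) → Space d) (a b : Fin (d + 1)) : Prop :=
  ∀ i j, i ≠ j → dist (p a) (p b) ≤ dist (p i) (p j)

/-- No edge sharing exactly one endpoint with the edge `a b` is longer than the edge `0 1`. -/
def FirstEdgeLongestAdjacent {d : ℕ} (p : Fin (d + 1) → Space d) (a b : Fin (d + 1)) : Prop :=
  ∀ i j, (i = a ∨ i = b) → (j ≠ a ∧ j ≠ b) → dist (p i) (p j) ≤ dist (p 0) (p 1)

/-- The closed half-space containing `a`, bounded by the hyperplane through the midpoint of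
the segment `a b` and perpendicular to it. -/
def halfSpace {d : ℕ} (a b : Space d) : Set (Space d) :=
  {x | 0 ≤ inner ℝ (x - midpoint ℝ a b) (a - b)}

/-- The edge conditions on the (ordered) vertices of an element. The vertices
`p₁, p₂, p₃, p₄` of the usual numbering are `p 0, p 1, p 2, p 3` here.

* Triangle: `p₂p₃` is the longest edge and `|p₁ - p₃| ≤ |p₁ - p₂|`.
* Tetrahedron: the shortest edge is `p₁p₃` (type (i)) or `p₂p₃` (type (ii)); `p₁p₂` is the
  longest of the four edges sharing one endpoint with it; with respect to the plane bisecting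
  `p₁p₂` perpendicularly, `p₄` is on the side of `p₁`, and `p₃` is on the side of `p₁` in
  type (i), on the side of `p₂` in type (ii). -/
def EdgeCondition : {d : ℕ} → ElementKind d → (Fin (d + 1) → Space d) → Prop
  | _, .triangle, p =>
      (∀ i j, dist (p i) (p j) ≤ dist (p 1) (p 2)) ∧ dist (p 0) (p 2) ≤ dist (p 0) (p 1)
  | _, .tetI, p =>
      IsMinEdge p 0 2 ∧ FirstEdgeLongestAdjacent p 0 2 ∧
        p 2 ∈ halfSpace (p 0) (p 1) ∧ p 3 ∈ halfSpace (p 0) (p 1)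
  | _, .tetII, p =>
      IsMinEdge p 1 2 ∧ FirstEdgeLongestAdjacent p 1 2 ∧
        p 2 ∈ halfSpace (p 1) (p 0) ∧ p 3 ∈ halfSpace (p 0) (p 1)

/-- The distinguished edge vectors `h_i r_i`: they are `p₂ - p₁`, `p₃ - p₁` for a triangle,
`p₂ - p₁`, `p₃ - p₁`, `p₄ - p₁` for a tetrahedron of type (i), and
`p₂ - p₁`, `p₃ - p₂`, `p₄ - p₁` for a tetrahedron of type (ii). -/
def edge : {d : ℕ} → ElementKind d → (Fin (d + 1) → Space d) → Fin d → Space d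
  | _, .triangle, p => ![p 1 - p 0, p 2 - p 0]
  | _, .tetI, p => ![p 1 - p 0, p 2 - p 0, p 3 - p 0]
  | _, .tetII, p => ![p 1 - p 0, p 2 - p 1, p 3 - p 0]

/-- The lengths `h_i`. -/
def edgeLength {d : ℕ} (k : ElementKind d) (p : Fin (d + 1) → Space d) (i : Fin d) : ℝ :=
  ‖edge k p i‖

/-- The unit directions `r_i`. -/
def edgeDir {d : ℕ} (k : ElementKind d) (p : Fin (d + 1) → Space d) (i : Fin d) : Space d :=
  (edgeLength k p i)⁻¹ • edge k p i

/-- The vertices of the reference element. -/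
def refVertex : {d : ℕ} → ElementKind d → Fin (d + 1) → Space d
  | _, .triangle => ![!₂[0, 0], !₂[1, 0], !₂[0, 1]]
  | _, .tetI => ![!₂[0, 0, 0], !₂[1, 0, 0], !₂[0, 1, 0], !₂[0, 0, 1]]
  | _, .tetII => ![!₂[0, 0, 0], !₂[1, 0, 0], !₂[1, 1, 0], !₂[0, 0, 1]]

/-- `g ∈ L²(T)ᵈ` is the weak gradient of `φ` on (the interior of) `T`: for every test function
`ψ ∈ C_c^∞(int T)` and every direction `v`, `∫_T φ ∂_v ψ = - ∫_T (g ⬝ v) ψ`. -/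
def IsWeakGradient {d : ℕ} (T : Set (Space d)) (φ : Space d → ℝ) (g : Space d → Space d) :
    Prop :=
  MemLp g 2 (volume.restrict T) ∧
    ∀ ψ : Space d → ℝ, ContDiff ℝ ∞ ψ → HasCompactSupport ψ → tsupport ψ ⊆ interior T →
      ∀ v : Space d,
        ∫ x in T, φ x * fderiv ℝ ψ x v = - ∫ x in T, inner ℝ (g x) v * ψ x

/-- `φ ∈ H¹(T)`. -/
def MemH1 {d : ℕ} (T : Set (Space d)) (φ : Space d → ℝ) : Prop :=
  MemLp φ 2 (volume.restrict T) ∧ ∃ g, IsWeakGradient T φ g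

/-- The mean value `Π_T⁰ φ = |T|⁻¹ ∫_T φ`. -/
def meanProj {d : ℕ} (T : Set (Space d)) (φ : Space d → ℝ) : ℝ :=
  (volume.real T)⁻¹ * ∫ x in T, φ x

/-- The estimate `‖Π_T⁰ φ - φ‖_{L²(T)} ≤ c ∑ i, h_i ‖∂φ/∂r_i‖_{L²(T)}` on the element `T` with
vertices `p`, where `∂φ/∂r_i = r_i ⬝ g` for the weak gradient `g` of `φ`. -/
def MeanEstimate {d : ℕ} (c : ℝ) (k : ElementKind d) (p : Fin (d + 1) → Space d)
    (φ : Space d → ℝ) : Prop :=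
  ∀ g : Space d → Space d, IsWeakGradient (simplex p) φ g →
    eLpNorm (fun x => meanProj (simplex p) φ - φ x) 2 (volume.restrict (simplex p)) ≤
      ENNReal.ofReal c * ∑ i : Fin d, ENNReal.ofReal (edgeLength k p i) *
        eLpNorm (fun x => inner ℝ (edgeDir k p i) (g x)) 2 (volume.restrict (simplex p))

end AnisoElement

end

namespace AnisoElement

/-! ### Poincaré's inequality for the double integral of a smooth function -/

section

/-! The proof is a Poincaré inequality on a convex body in which the directions are kept apart. The
shape of the element enters only through `exists_coords_sub`: for `x, y ∈ T`, barycentric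
coordinates give `x - y = ∑ aᵢ eᵢ` with `|aᵢ| ≤ 1`, the `eᵢ` being the distinguished edge vectors.
Hence no angle or aspect ratio appears.

For smooth `u`, integrating along the segment and using Cauchy–Schwarz bounds `|u x - u y|²` by `d ∑
∫₀¹ |∂u/∂eᵢ (y + t(x - y))|² dt`. Integrated over `T × T`, this is at most `2^d |T| d ∑ ‖∂u/∂eᵢ‖²`
(`lintegral_lintegral_segment_le`).

For `φ ∈ H¹` the bound is proved for mollifications on convex sets at positive distance from the
boundary, passed to the limit by Fatou, and extended by exhausting the interior
(`lintegral_lintegral_enorm_sub_sq_le`). Cauchy–Schwarz for the mean then gives `‖Πφ - φ‖² ≤ 2^d d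
(∑ ‖∂φ/∂eᵢ‖)²`. Since `∂/∂eᵢ = hᵢ ∂/∂rᵢ` and `2^d d ≤ 24`, the constant `5` serves.

For transported functions it remains to see that affine bijections preserve `H¹`. -/

theorem lintegral_mul_sq_le {α : Type*} [MeasurableSpace α] {μ : Measure α} {f g : α → ℝ≥0∞}
    (hf : AEMeasurable f μ) (hg : AEMeasurable g μ) :
    (∫⁻ x, f x * g x ∂μ) ^ 2 ≤ (∫⁻ x, f x ^ 2 ∂μ) * ∫⁻ x, g x ^ 2 ∂μ := by
  have h := ENNReal.lintegral_mul_le_Lp_mul_Lq μ Real.HolderConjugate.two_two hf hg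
  simp only [Pi.mul_apply, ENNReal.rpow_ofNat] at h
  calc (∫⁻ x, f x * g x ∂μ) ^ 2 ≤ _ := pow_le_pow_left' h 2
    _ = _ := by
      rw [mul_pow, ← ENNReal.rpow_mul_natCast, ← ENNReal.rpow_mul_natCast]
      norm_num

theorem lintegral_sq_le {α : Type*} [MeasurableSpace α] {μ : Measure α} {f : α → ℝ≥0∞}
    (hf : AEMeasurable f μ) :
    (∫⁻ x, f x ∂μ) ^ 2 ≤ μ univ * ∫⁻ x, f x ^ 2 ∂μ := by
  simpa using lintegral_mul_sq_le (μ := μ) (f := fun _ => 1) aemeasurable_const hf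

theorem enorm_sum_mul_sq_le {ι : Type*} [Fintype ι] {a v : ι → ℝ} (ha : ∀ i, |a i| ≤ 1) :
    ‖∑ i, a i * v i‖ₑ ^ 2 ≤ Fintype.card ι * ∑ i, ‖v i‖ₑ ^ 2 := by
  have h : (∑ i, a i * v i) ^ 2 ≤ Fintype.card ι * ∑ i, (v i) ^ 2 := by
    refine sq_sum_le_card_mul_sum_sq.trans ?_
    rw [Finset.card_univ]
    refine mul_le_mul_of_nonneg_left (Finset.sum_le_sum fun i _ => ?_) (Nat.cast_nonneg _)
    rw [mul_pow]
    exact mul_le_of_le_one_left (sq_nonneg _) ((sq_le_one_iff_abs_le_one _).2 (ha i))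
  have e : ∀ x : ℝ, ‖x‖ₑ ^ 2 = ENNReal.ofReal (x ^ 2) := fun x => by
    rw [← ofReal_norm, ← ENNReal.ofReal_pow (norm_nonneg _), Real.norm_eq_abs, sq_abs]
  simp only [e]
  rw [← ENNReal.ofReal_sum_of_nonneg fun i _ => sq_nonneg _, ← ENNReal.ofReal_natCast,
    ← ENNReal.ofReal_mul (by positivity)]
  exact ENNReal.ofReal_le_ofReal h

section Smooth

variable {E : Type*} [NormedAddCommGroup E] [NormedSpace ℝ E]

/-- Fundamental theorem of calculus on the segment, then Cauchy–Schwarz twice: in `t` over an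
interval of length one, and in the finite sum over the directions. -/
theorem enorm_sub_sq_le_lintegral_segment {ι : Type*} [Fintype ι] {u : E → ℝ}
    (hu : ContDiff ℝ 1 u) {x y : E} {e : ι → E} {a : ι → ℝ} (ha : ∀ i, |a i| ≤ 1)
    (hxy : x - y = ∑ i, a i • e i) :
    ‖u x - u y‖ₑ ^ 2 ≤ ∫⁻ t in Icc (0 : ℝ) 1,
      Fintype.card ι * ∑ i, ‖fderiv ℝ u (y + t • (x - y)) (e i)‖ₑ ^ 2 := by
  have hc : Continuous fun t : ℝ => fderiv ℝ u (y + t • (x - y)) (x - y) :=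
    ((hu.continuous_fderiv one_ne_zero).comp (by fun_prop)).clm_apply continuous_const
  have hd : ∀ t : ℝ, HasDerivAt (fun t : ℝ => u (y + t • (x - y)))
      (fderiv ℝ u (y + t • (x - y)) (x - y)) t := fun t => by
    refine ((hu.differentiable one_ne_zero _).hasFDerivAt).comp_hasDerivAt t ?_
    simpa using ((hasDerivAt_id t).smul_const (x - y)).const_add y
  have h := intervalIntegral.integral_eq_sub_of_hasDerivAt (a := 0) (b := 1)
    (fun t _ => hd t) (hc.intervalIntegrable _ _)
  simp only [one_smul, add_sub_cancel, zero_smul, add_zero] at h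
  rw [← h, intervalIntegral.integral_of_le zero_le_one, ← integral_Icc_eq_integral_Ioc]
  calc _ ≤ (∫⁻ t in Icc (0 : ℝ) 1, ‖fderiv ℝ u (y + t • (x - y)) (x - y)‖ₑ) ^ 2 :=
        pow_le_pow_left' (enorm_integral_le_lintegral_enorm _) 2
    _ ≤ _ := lintegral_sq_le hc.enorm.aemeasurable
    _ = ∫⁻ t in Icc (0 : ℝ) 1, ‖fderiv ℝ u (y + t • (x - y)) (x - y)‖ₑ ^ 2 := by simp
    _ ≤ _ := by
      refine lintegral_mono fun t => ?_
      have h1 : fderiv ℝ u (y + t • (x - y)) (x - y)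
          = ∑ i, a i * fderiv ℝ u (y + t • (x - y)) (e i) := by
        conv_lhs => rw [hxy]
        rw [map_sum, ← hxy]
        simp
      simp only [h1]
      exact enorm_sum_mul_sq_le ha

variable [MeasurableSpace E] [BorelSpace E] [FiniteDimensional ℝ E] {μ : Measure E}
  [μ.IsAddHaarMeasure]

theorem lintegral_comp_smul_le {t : ℝ} (ht : 1 / 2 ≤ t) {H : E → ℝ≥0∞} (hH : Measurable H) :
    ∫⁻ x, H (t • x) ∂μ ≤ 2 ^ Module.finrank ℝ E * ∫⁻ x, H x ∂μ := by
  have ht0 : 0 < t := by linarith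
  rw [← lintegral_map hH (measurable_const_smul t), Measure.map_addHaar_smul μ ht0.ne',
    lintegral_smul_measure, smul_eq_mul]
  gcongr
  rw [abs_of_pos (by positivity), ← inv_pow, ENNReal.ofReal_pow (by positivity)]
  gcongr
  rw [← ENNReal.ofReal_ofNat]
  refine ENNReal.ofReal_le_ofReal ?_
  rw [inv_le_comm₀ ht0 two_pos]
  linarith

/-- Dilation towards a point `y` of a convex set with a ratio at least `1 / 2`. -/
theorem setLIntegral_dilation_le {K : Set E} (hK : Convex ℝ K) (hKm : MeasurableSet K)
    {G : E → ℝ≥0∞} (hG : Measurable G) {y : E} (hy : y ∈ K) {t : ℝ} (ht : t ∈ Icc (1 / 2) (1 : ℝ)) :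
    ∫⁻ x in K, G (y + t • (x - y)) ∂μ ≤ 2 ^ Module.finrank ℝ E * ∫⁻ x in K, G x ∂μ := by
  have h0 : 0 ≤ t := by linarith [ht.1]
  -- By convexity the dilated point stays in `K`, so `G` may be cut off to `K` before the domain is
  -- enlarged to the whole space.
  calc ∫⁻ x in K, G (y + t • (x - y)) ∂μ
      = ∫⁻ x in K, K.indicator G (y + t • (x - y)) ∂μ := by
        refine setLIntegral_congr_fun hKm fun x hx => ?_
        rw [indicator_of_mem (hK.add_smul_sub_mem hy hx ⟨h0, ht.2⟩)]
    _ ≤ ∫⁻ x, K.indicator G (y + t • (x - y)) ∂μ := setLIntegral_le_lintegral _ _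
    _ = ∫⁻ x, K.indicator G (y + t • x) ∂μ :=
        lintegral_sub_right_eq_self (fun x => K.indicator G (y + t • x)) y
    _ ≤ 2 ^ Module.finrank ℝ E * ∫⁻ x, K.indicator G (y + x) ∂μ :=
        lintegral_comp_smul_le ht.1 (H := fun x => K.indicator G (y + x))
          ((hG.indicator hKm).comp (measurable_const_add y))
    _ = _ := by
        rw [lintegral_add_left_eq_self (fun x => K.indicator G x), lintegral_indicator hKm]

/-- For fixed `t`, the map to `y + t(x - y)` is a dilation of ratio `t` in `x` and of ratio `1 - t`
in `y`. One of the two ratios is at least `1 / 2`; integrating in that variable first costs a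
Jacobian of at most `2^n`, with `n` the dimension. -/
theorem lintegral_lintegral_segment_le {K : Set E} (hK : Convex ℝ K) (hKm : MeasurableSet K)
    (hKf : μ K ≠ ⊤) {G : E → ℝ≥0∞} (hG : Measurable G) :
    ∫⁻ x in K, ∫⁻ y in K, (∫⁻ t in Icc (0 : ℝ) 1, G (y + t • (x - y))) ∂μ ∂μ ≤
      2 ^ Module.finrank ℝ E * μ K * ∫⁻ x in K, G x ∂μ := by
  have : Fact (μ K < ⊤) := ⟨hKf.lt_top⟩
  set A : ℝ≥0∞ := 2 ^ Module.finrank ℝ E * ∫⁻ x in K, G x ∂μ with hA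
  have hm1 : Measurable fun q : ℝ × E × E => G (q.2.2 + q.1 • (q.2.1 - q.2.2)) :=
    hG.comp (by fun_prop)
  have hm2 : Measurable fun q : E × E × ℝ => G (q.2.1 + q.2.2 • (q.1 - q.2.1)) :=
    hG.comp (by fun_prop)
  have key : ∀ t ∈ Icc (0 : ℝ) 1,
      ∫⁻ x in K, ∫⁻ y in K, G (y + t • (x - y)) ∂μ ∂μ ≤ A * μ K := by
    intro t ht
    have aux : ∀ s ∈ Icc (1 / 2) (1 : ℝ), ∀ y ∈ K, ∫⁻ x in K, G (y + s • (x - y)) ∂μ ≤ A :=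
      fun s hs y hy => setLIntegral_dilation_le hK hKm hG hy hs
    have bound : ∀ F : E → ℝ≥0∞, (∀ x ∈ K, F x ≤ A) → ∫⁻ x in K, F x ∂μ ≤ A * μ K :=
      fun F hF => (setLIntegral_mono measurable_const hF).trans (by simp)
    rcases le_total (1 / 2) t with h | h
    · rw [lintegral_lintegral_swap]
      · exact bound _ (aux t ⟨h, ht.2⟩)
      · exact (hm1.comp (measurable_const.prodMk measurable_id)).aemeasurable
    · refine bound _ fun x hx => ?_
      refine le_trans (le_of_eq (lintegral_congr fun y => ?_))
        (aux (1 - t) ⟨by linarith, by linarith [ht.1]⟩ x hx)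
      congr 1
      module
  calc ∫⁻ x in K, ∫⁻ y in K, (∫⁻ t in Icc (0 : ℝ) 1, G (y + t • (x - y))) ∂μ ∂μ
      = ∫⁻ x in K, (∫⁻ t in Icc (0 : ℝ) 1, (∫⁻ y in K, G (y + t • (x - y)) ∂μ)) ∂μ := by
        refine lintegral_congr fun x => lintegral_lintegral_swap ?_
        exact (hm2.comp (measurable_const.prodMk measurable_id)).aemeasurable
    _ = ∫⁻ t in Icc (0 : ℝ) 1, (∫⁻ x in K, ∫⁻ y in K, G (y + t • (x - y)) ∂μ ∂μ) := by
        refine lintegral_lintegral_swap (Measurable.aemeasurable ?_)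
        have hm3 : Measurable fun q : (E × ℝ) × E => G (q.2 + q.1.2 • (q.1.1 - q.2)) :=
          hG.comp (by fun_prop)
        exact hm3.lintegral_prod_right'
    _ ≤ ∫⁻ t in Icc (0 : ℝ) 1, A * μ K := setLIntegral_mono measurable_const key
    _ = _ := by simp [hA]; ring

/-- Poincaré's inequality for the double integral of a `C¹` function on a convex set. -/
theorem lintegral_lintegral_enorm_sub_sq_le_of_contDiff {ι : Type*} [Fintype ι] {K : Set E}
    (hK : Convex ℝ K) (hKm : MeasurableSet K) (hKf : μ K ≠ ⊤) {e : ι → E}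
    (he : ∀ x ∈ K, ∀ y ∈ K, ∃ a : ι → ℝ, (∀ i, |a i| ≤ 1) ∧ x - y = ∑ i, a i • e i)
    {u : E → ℝ} (hu : ContDiff ℝ 1 u) :
    ∫⁻ x in K, ∫⁻ y in K, ‖u x - u y‖ₑ ^ 2 ∂μ ∂μ ≤
      2 ^ Module.finrank ℝ E * μ K *
        (Fintype.card ι * ∑ i, ∫⁻ x in K, ‖fderiv ℝ u x (e i)‖ₑ ^ 2 ∂μ) := by
  have hm : ∀ i, Measurable fun x => ‖fderiv ℝ u x (e i)‖ₑ ^ 2 := fun i =>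
    (((hu.continuous_fderiv one_ne_zero).clm_apply continuous_const).measurable.enorm).pow_const 2
  have hG : Measurable fun x => (Fintype.card ι : ℝ≥0∞) * ∑ i, ‖fderiv ℝ u x (e i)‖ₑ ^ 2 :=
    (Finset.measurable_sum _ fun i _ => hm i).const_mul _
  calc _ ≤ ∫⁻ x in K, ∫⁻ y in K, (∫⁻ t in Icc (0 : ℝ) 1,
        Fintype.card ι * ∑ i, ‖fderiv ℝ u (y + t • (x - y)) (e i)‖ₑ ^ 2) ∂μ ∂μ := by
        refine setLIntegral_mono' hKm fun x hx => setLIntegral_mono' hKm fun y hy => ?_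
        obtain ⟨a, ha, h⟩ := he x hx y hy
        exact enorm_sub_sq_le_lintegral_segment hu ha h
    _ ≤ _ := lintegral_lintegral_segment_le hK hKm hKf hG
    _ = _ := by
        rw [lintegral_const_mul _ (Finset.measurable_sum _ fun i _ => hm i),
          lintegral_finsetSum _ fun i _ => hm i]

end Smooth

end

/-! ### Mollification and passage to weak gradients -/

section

/-- Cauchy–Schwarz with respect to the measure of density `ρ`. -/
theorem lintegral_density_mul_sq_le {α : Type*} [MeasurableSpace α] {μ : Measure α}
    {ρ f : α → ℝ≥0∞} (hρ : Measurable ρ) (hf : AEMeasurable f μ) :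
    (∫⁻ x, ρ x * f x ∂μ) ^ 2 ≤ (∫⁻ x, ρ x ∂μ) * ∫⁻ x, ρ x * f x ^ 2 ∂μ := by
  have h := lintegral_sq_le (hf.mono_ac (withDensity_absolutelyContinuous μ ρ))
  rwa [lintegral_withDensity_eq_lintegral_mul₀ hρ.aemeasurable hf,
    lintegral_withDensity_eq_lintegral_mul₀ hρ.aemeasurable (hf.pow_const 2),
    withDensity_apply _ MeasurableSet.univ, setLIntegral_univ] at h

/-- Young's inequality for the convolution of an `L²` function with a density of mass at most
one. -/
theorem setLIntegral_mollify_sq_le {E : Type*} [NormedAddCommGroup E] [MeasurableSpace E]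
    [BorelSpace E] [SecondCountableTopology E] {μ : Measure E} [SFinite μ] [μ.IsAddLeftInvariant]
    [μ.IsNegInvariant] {ρ f : E → ℝ≥0∞} (hρ : Measurable ρ) (hρ1 : ∫⁻ x, ρ x ∂μ ≤ 1) {K T : Set E}
    (hf : AEMeasurable f (μ.restrict T)) :
    ∫⁻ x in K, (∫⁻ t in T, ρ (x - t) * f t ∂μ) ^ 2 ∂μ ≤ ∫⁻ t in T, f t ^ 2 ∂μ := by
  calc _ ≤ ∫⁻ x in K, ∫⁻ t in T, ρ (x - t) * f t ^ 2 ∂μ ∂μ := by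
        refine lintegral_mono fun x => ?_
        have hm : Measurable fun t => ρ (x - t) := hρ.comp (measurable_const_sub x)
        refine (lintegral_density_mul_sq_le hm hf).trans ?_
        refine mul_le_of_le_one_left' ?_
        refine (setLIntegral_le_lintegral _ _).trans ?_
        rwa [lintegral_sub_left_eq_self ρ x]
    _ = ∫⁻ t in T, ∫⁻ x in K, ρ (x - t) * f t ^ 2 ∂μ ∂μ := by
        refine lintegral_lintegral_swap ?_
        exact (hρ.comp (measurable_fst.sub measurable_snd)).aemeasurable.mul
          (hf.comp_snd.pow_const 2)
    _ ≤ _ := by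
        refine lintegral_mono fun t => ?_
        have hm : Measurable fun x => ρ (x - t) := hρ.comp (measurable_sub_const t)
        dsimp only
        rw [lintegral_mul_const _ hm]
        refine mul_le_of_le_one_left' ?_
        refine (setLIntegral_le_lintegral _ _).trans ?_
        rwa [lintegral_sub_right_eq_self ρ t]

variable {d : ℕ} {T : Set (Space d)} {φ : Space d → ℝ} {g : Space d → Space d}

theorem integrable_indicator_of_memLp (hT : IsCompact T)
    (hφ : MemLp φ 2 (volume.restrict T)) : Integrable (T.indicator φ) := by
  have : Fact (volume T < ⊤) := ⟨hT.measure_lt_top⟩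
  exact (integrable_indicator_iff hT.measurableSet).2 (hφ.integrable one_le_two)

/-- The mollification of the extension by zero of `φ`. -/
noncomputable def mollify (η : ContDiffBump (0 : Space d)) (T : Set (Space d))
    (φ : Space d → ℝ) : Space d → ℝ :=
  convolution (η.normed volume) (T.indicator φ) (ContinuousLinearMap.lsmul ℝ ℝ) volume

theorem contDiff_mollify (η : ContDiffBump (0 : Space d)) (hT : IsCompact T)
    (hφ : MemLp φ 2 (volume.restrict T)) : ContDiff ℝ 1 (mollify η T φ) :=
  HasCompactSupport.contDiff_convolution_left (n := 1) _ η.hasCompactSupport_normed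
    η.contDiff_normed (integrable_indicator_of_memLp hT hφ).locallyIntegrable

theorem fderiv_mollify (η : ContDiffBump (0 : Space d)) (hT : IsCompact T)
    (hφ : MemLp φ 2 (volume.restrict T)) (x v : Space d) :
    fderiv ℝ (mollify η T φ) x v = ∫ t in T, φ t * fderiv ℝ (η.normed volume) (x - t) v := by
  have hl := (integrable_indicator_of_memLp hT hφ).locallyIntegrable
  have hc : HasCompactSupport (η.normed (volume : Measure (Space d))) := η.hasCompactSupport_normed
  have hd : ContDiff ℝ 1 (η.normed (volume : Measure (Space d))) := η.contDiff_normed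
  rw [mollify, (hc.hasFDerivAt_convolution_left (ContinuousLinearMap.lsmul ℝ ℝ) hd hl x).fderiv,
    convolution, ContinuousLinearMap.integral_apply]
  · rw [← integral_sub_left_eq_self _ _ x, ← integral_indicator hT.measurableSet]
    refine integral_congr_ae (Filter.Eventually.of_forall fun t => ?_)
    by_cases ht : t ∈ T <;> simp [ContinuousLinearMap.precompL_apply, ht, mul_comm]
  · exact hc.fderiv (𝕜 := ℝ) |>.convolutionExists_left _ (hd.continuous_fderiv one_ne_zero) hl x

/-- When the ball around `x` lies inside `T`, `t ↦ η(x - t)` is an admissible test function. The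
sign from differentiating `x - t` cancels the one in the definition of the weak gradient. -/
theorem fderiv_mollify_eq_of_isWeakGradient (η : ContDiffBump (0 : Space d)) (hT : IsCompact T)
    (hφ : MemLp φ 2 (volume.restrict T)) (hg : IsWeakGradient T φ g) {x : Space d}
    (hx : Metric.closedBall x η.rOut ⊆ interior T) (v : Space d) :
    fderiv ℝ (mollify η T φ) x v = ∫ t in T, inner ℝ (g t) v * η.normed volume (x - t) := by
  have hs : tsupport (fun t => η.normed volume (x - t)) ⊆ Metric.closedBall x η.rOut := by
    refine closure_minimal (fun t ht => ?_) Metric.isClosed_closedBall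
    have h : x - t ∈ Function.support (η.normed volume) := ht
    rw [η.support_normed_eq, mem_ball_zero_iff] at h
    rw [Metric.mem_closedBall, dist_comm, dist_eq_norm]
    exact h.le
  have h := hg.2 (fun t => η.normed volume (x - t)) (η.contDiff_normed.comp (by fun_prop))
    (HasCompactSupport.of_support_subset_isCompact (isCompact_closedBall x η.rOut)
      (subset_closure.trans hs)) (hs.trans hx) v
  have hf : ∀ t, fderiv ℝ (fun t => η.normed volume (x - t)) t v
      = -fderiv ℝ (η.normed volume) (x - t) v := fun t => by
    have hd : DifferentiableAt ℝ (η.normed (volume : Measure (Space d))) (x - t) :=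
      (η.contDiff_normed (n := 1)).differentiable one_ne_zero _
    have hd' : HasFDerivAt (fun t => η.normed volume (x - t)) _ t :=
      hd.hasFDerivAt.comp t ((hasFDerivAt_id t).const_sub x)
    rw [hd'.fderiv]
    simp
  simp only [hf, mul_neg, integral_neg, neg_inj] at h
  rw [fderiv_mollify η hT hφ, h]

theorem setLIntegral_fderiv_mollify_le (η : ContDiffBump (0 : Space d)) (hT : IsCompact T)
    (hφ : MemLp φ 2 (volume.restrict T)) (hg : IsWeakGradient T φ g) {K : Set (Space d)}
    (hKm : MeasurableSet K) (hK : ∀ x ∈ K, Metric.closedBall x η.rOut ⊆ interior T)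
    (v : Space d) :
    ∫⁻ x in K, ‖fderiv ℝ (mollify η T φ) x v‖ₑ ^ 2 ≤ ∫⁻ t in T, ‖inner ℝ (g t) v‖ₑ ^ 2 := by
  have hρ : Measurable fun x => ‖η.normed (volume : Measure (Space d)) x‖ₑ :=
    η.continuous_normed.measurable.enorm
  have hρ1 : ∫⁻ x, ‖η.normed (volume : Measure (Space d)) x‖ₑ ≤ 1 := by
    rw [← ofReal_integral_norm_eq_lintegral_enorm η.integrable_normed]
    simp only [Real.norm_of_nonneg (η.nonneg_normed _), η.integral_normed, ENNReal.ofReal_one,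
      le_refl]
  have hf : AEMeasurable (fun t => ‖inner ℝ (g t) v‖ₑ) (volume.restrict T) :=
    (hg.1.1.inner aestronglyMeasurable_const).enorm
  refine le_trans (setLIntegral_mono' hKm fun x hx => ?_)
    (setLIntegral_mollify_sq_le (K := K) hρ hρ1 hf)
  rw [fderiv_mollify_eq_of_isWeakGradient η hT hφ hg (hK x hx)]
  refine pow_le_pow_left' ((enorm_integral_le_lintegral_enorm _).trans (le_of_eq ?_)) 2
  refine lintegral_congr fun t => ?_
  rw [enorm_mul, mul_comm]

/-- Bumps of outer radii `ε / (n + 1)`. -/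
noncomputable def shrinkingBump (d : ℕ) {ε : ℝ} (hε : 0 < ε) (n : ℕ) :
    ContDiffBump (0 : Space d) where
  rIn := ε / (n + 1) / 2
  rOut := ε / (n + 1)
  rIn_pos := by positivity
  rIn_lt_rOut := half_lt_self (by positivity)

theorem shrinkingBump_rOut_le {ε : ℝ} (hε : 0 < ε) (n : ℕ) : (shrinkingBump d hε n).rOut ≤ ε :=
  div_le_self hε.le (by linarith [(Nat.cast_nonneg n : (0 : ℝ) ≤ n)])

theorem ae_tendsto_mollify (hT : IsCompact T) (hφ : MemLp φ 2 (volume.restrict T)) {ε : ℝ}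
    (hε : 0 < ε) : ∀ᵐ x ∂volume.restrict T, Filter.Tendsto
      (fun n => mollify (shrinkingBump d hε n) T φ x) Filter.atTop (nhds (φ x)) := by
  have h0 : Filter.Tendsto (fun n => (shrinkingBump d hε n).rOut) Filter.atTop (nhds 0) :=
    ((tendsto_const_div_atTop_nhds_zero_nat ε).comp (Filter.tendsto_add_atTop_nat 1)).congr
      fun n => by simp [shrinkingBump]
  -- A bounded ratio of the radii is what gives almost everywhere convergence at Lebesgue points.
  have h1 : ∀ n, (shrinkingBump d hε n).rOut ≤ 2 * (shrinkingBump d hε n).rIn := fun n => by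
    change ε / (n + 1) ≤ 2 * (ε / (n + 1) / 2)
    linarith
  have h := ContDiffBump.ae_convolution_tendsto_right_of_locallyIntegrable (μ := volume) h0
    (Filter.Eventually.of_forall h1) (integrable_indicator_of_memLp hT hφ).locallyIntegrable
  filter_upwards [ae_restrict_of_ae h, ae_restrict_mem hT.measurableSet] with x hx hxT
  rwa [indicator_of_mem hxT] at hx

/-- Fatou's lemma for the double integral of squared differences. -/
theorem lintegral_lintegral_enorm_sub_sq_le_of_tendsto {α : Type*} [MeasurableSpace α]
    {μ : Measure α} [SFinite μ] {u : ℕ → α → ℝ} {φ : α → ℝ} (hm : ∀ n, Measurable (u n))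
    (hlim : ∀ᵐ x ∂μ, Filter.Tendsto (fun n => u n x) Filter.atTop (nhds (φ x))) {C : ℝ≥0∞}
    (hC : ∀ n, ∫⁻ x, ∫⁻ y, ‖u n x - u n y‖ₑ ^ 2 ∂μ ∂μ ≤ C) :
    ∫⁻ x, ∫⁻ y, ‖φ x - φ y‖ₑ ^ 2 ∂μ ∂μ ≤ C := by
  have hm2 : ∀ n, Measurable fun q : α × α => ‖u n q.1 - u n q.2‖ₑ ^ 2 := fun n =>
    (((hm n).comp measurable_fst).sub ((hm n).comp measurable_snd)).enorm.pow_const 2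
  calc ∫⁻ x, ∫⁻ y, ‖φ x - φ y‖ₑ ^ 2 ∂μ ∂μ
      ≤ ∫⁻ x, Filter.liminf (fun n => ∫⁻ y, ‖u n x - u n y‖ₑ ^ 2 ∂μ) Filter.atTop ∂μ := by
        refine lintegral_mono_ae ?_
        filter_upwards [hlim] with x hx
        refine le_trans (lintegral_mono_ae ?_)
          (lintegral_liminf_le fun n => (hm2 n).comp (measurable_const.prodMk measurable_id))
        filter_upwards [hlim] with y hy
        refine le_of_eq (Filter.Tendsto.liminf_eq ?_).symm
        exact ENNReal.Tendsto.pow ((continuous_enorm.tendsto _).comp (hx.sub hy))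
    _ ≤ Filter.liminf (fun n => ∫⁻ x, ∫⁻ y, ‖u n x - u n y‖ₑ ^ 2 ∂μ ∂μ) Filter.atTop :=
        lintegral_liminf_le fun n => (hm2 n).lintegral_prod_right'
    _ ≤ C := Filter.liminf_le_of_frequently_le' (Filter.Frequently.of_forall hC)

theorem lintegral_lintegral_enorm_sub_sq_le_of_thickening {ι : Type*} [Fintype ι]
    (hT : IsCompact T) (hφ : MemLp φ 2 (volume.restrict T)) (hg : IsWeakGradient T φ g)
    {K : Set (Space d)} (hK : Convex ℝ K) (hKm : MeasurableSet K) {ε : ℝ} (hε : 0 < ε)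
    (hKT : ∀ x ∈ K, Metric.closedBall x ε ⊆ interior T) {e : ι → Space d}
    (he : ∀ x ∈ K, ∀ y ∈ K, ∃ a : ι → ℝ, (∀ i, |a i| ≤ 1) ∧ x - y = ∑ i, a i • e i) :
    ∫⁻ x in K, ∫⁻ y in K, ‖φ x - φ y‖ₑ ^ 2 ≤
      2 ^ d * volume T * (Fintype.card ι * ∑ i, ∫⁻ x in T, ‖inner ℝ (g x) (e i)‖ₑ ^ 2) := by
  have hKT' : K ⊆ T := fun x hx =>
    interior_subset (hKT x hx (Metric.mem_closedBall_self hε.le))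
  have hle : volume K ≤ volume T := measure_mono hKT'
  refine lintegral_lintegral_enorm_sub_sq_le_of_tendsto
    (fun n => (contDiff_mollify (shrinkingBump d hε n) hT hφ).continuous.measurable)
    (ae_restrict_of_ae_restrict_of_subset hKT' (ae_tendsto_mollify hT hφ hε)) fun n => ?_
  refine (lintegral_lintegral_enorm_sub_sq_le_of_contDiff hK hKm
    (hle.trans_lt hT.measure_lt_top).ne he (contDiff_mollify _ hT hφ)).trans ?_
  rw [finrank_euclideanSpace_fin]
  refine mul_le_mul' (mul_le_mul_right hle _)
    (mul_le_mul_right (Finset.sum_le_sum fun i _ => ?_) _)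
  exact setLIntegral_fderiv_mollify_le _ hT hφ hg hKm
    (fun x hx => (Metric.closedBall_subset_closedBall (shrinkingBump_rOut_le hε n)).trans
      (hKT x hx)) _

end

/-! ### Poincaré's inequality on convex bodies and on the elements -/

section

/-- For increasing `s n`, the squares `s n ×ˢ s n` increase to the square of the union, so monotone
convergence applies on the product. -/
theorem lintegral_lintegral_iUnion_le {α : Type*} [MeasurableSpace α] {μ : Measure α} [SFinite μ]
    {s : ℕ → Set α} (hs : Monotone s) {F : α × α → ℝ≥0∞}
    (hF : AEMeasurable F ((μ.restrict (⋃ n, s n)).prod (μ.restrict (⋃ n, s n)))) {C : ℝ≥0∞}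
    (hC : ∀ n, ∫⁻ x in s n, ∫⁻ y in s n, F (x, y) ∂μ ∂μ ≤ C) :
    ∫⁻ x in ⋃ n, s n, ∫⁻ y in ⋃ n, s n, F (x, y) ∂μ ∂μ ≤ C := by
  rw [← lintegral_prod F hF, Measure.prod_restrict, ← iUnion_prod_of_monotone hs hs,
    setLIntegral_iUnion_of_directed]
  · refine iSup_le fun n => ?_
    rw [← Measure.prod_restrict, lintegral_prod]
    · exact hC n
    · refine hF.mono_measure ?_
      rw [Measure.prod_restrict, Measure.prod_restrict]
      exact Measure.restrict_mono (prod_mono (subset_iUnion s n) (subset_iUnion s n)) le_rfl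
  · exact (show Monotone fun n => s n ×ˢ s n from
      fun m n h => prod_mono (hs h) (hs h)).directed_le

/-- The points whose closed `ε`-ball is contained in `T`. -/
def erosion {d : ℕ} (T : Set (Space d)) (ε : ℝ) : Set (Space d) :=
  {x | Metric.closedBall x ε ⊆ T}

variable {d : ℕ} {T : Set (Space d)}

theorem erosion_eq_iInter (T : Set (Space d)) (ε : ℝ) :
    erosion T ε = ⋂ h ∈ Metric.closedBall (0 : Space d) ε, (fun x => x + h) ⁻¹' T := by
  ext x
  rw [mem_iInter₂]
  constructor
  · intro h v hv
    exact h (by simpa using hv)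
  · intro h y hy
    have := h (y - x) (by simpa [dist_eq_norm] using hy)
    rwa [mem_preimage, add_sub_cancel] at this

theorem convex_erosion (hT : Convex ℝ T) (ε : ℝ) : Convex ℝ (erosion T ε) := by
  rw [erosion_eq_iInter]
  exact convex_iInter₂ fun h _ => hT.translate_preimage_left h

theorem isClosed_erosion (hT : IsClosed T) (ε : ℝ) : IsClosed (erosion T ε) := by
  rw [erosion_eq_iInter]
  exact isClosed_biInter fun h _ => hT.preimage (continuous_add_const h)

theorem erosion_antitone (T : Set (Space d)) : Antitone (erosion T) :=
  fun _ _ h _ hx => (Metric.closedBall_subset_closedBall h).trans hx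

theorem iUnion_erosion (T : Set (Space d)) :
    ⋃ n : ℕ, erosion T (1 / (n + 1)) = interior T := by
  ext x
  rw [mem_iUnion, mem_interior_iff_mem_nhds]
  constructor
  · rintro ⟨n, h⟩
    exact Filter.mem_of_superset (Metric.closedBall_mem_nhds x Nat.one_div_pos_of_nat) h
  · intro h
    obtain ⟨ε, hε, h⟩ := Metric.nhds_basis_closedBall.mem_iff.1 h
    obtain ⟨n, hn⟩ := exists_nat_one_div_lt hε
    exact ⟨n, (Metric.closedBall_subset_closedBall hn.le).trans h⟩

theorem closedBall_half_subset_interior {ε : ℝ} (hε : 0 < ε) {x : Space d}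
    (hx : x ∈ erosion T ε) : Metric.closedBall x (ε / 2) ⊆ interior T :=
  interior_maximal (Metric.ball_subset_closedBall.trans hx) Metric.isOpen_ball |>.trans'
    (Metric.closedBall_subset_ball (half_lt_self hε))

variable {φ : Space d → ℝ} {g : Space d → Space d}

/-- Poincaré's inequality for the double integral of an `H¹` function on a convex body. -/
theorem lintegral_lintegral_enorm_sub_sq_le {ι : Type*} [Fintype ι]
    (hT : IsCompact T) (hTc : Convex ℝ T) (hφ : MemLp φ 2 (volume.restrict T))
    (hg : IsWeakGradient T φ g) {e : ι → Space d}
    (he : ∀ x ∈ T, ∀ y ∈ T, ∃ a : ι → ℝ, (∀ i, |a i| ≤ 1) ∧ x - y = ∑ i, a i • e i) :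
    ∫⁻ x in T, ∫⁻ y in T, ‖φ x - φ y‖ₑ ^ 2 ≤
      2 ^ d * volume T * (Fintype.card ι * ∑ i, ∫⁻ x in T, ‖inner ℝ (g x) (e i)‖ₑ ^ 2) := by
  -- The erosions exhaust only the interior, but the boundary of a convex set is null.
  have hr : volume.restrict T = volume.restrict (⋃ n : ℕ, erosion T (1 / (n + 1))) := by
    rw [iUnion_erosion]
    exact (Measure.restrict_congr_set
      (interior_ae_eq_of_null_frontier (hTc.addHaar_frontier volume))).symm
  have hsub : ∀ n : ℕ, erosion T (1 / (n + 1)) ⊆ T := fun n =>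
    (subset_iUnion (fun n : ℕ => erosion T (1 / (n + 1))) n).trans
      ((iUnion_erosion T).subset.trans interior_subset)
  have hm : AEMeasurable (fun q : Space d × Space d => ‖φ q.1 - φ q.2‖ₑ ^ 2)
      ((volume.restrict T).prod (volume.restrict T)) :=
    (hφ.1.comp_fst.sub hφ.1.comp_snd).enorm.pow_const 2
  have key : ∀ n : ℕ,
      ∫⁻ x in erosion T (1 / (n + 1)), ∫⁻ y in erosion T (1 / (n + 1)), ‖φ x - φ y‖ₑ ^ 2 ≤
      2 ^ d * volume T * (Fintype.card ι * ∑ i, ∫⁻ x in T, ‖inner ℝ (g x) (e i)‖ₑ ^ 2) := fun n =>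
    lintegral_lintegral_enorm_sub_sq_le_of_thickening hT hφ hg (convex_erosion hTc _)
      (isClosed_erosion hT.isClosed _).measurableSet (half_pos Nat.one_div_pos_of_nat)
      (fun x hx => closedBall_half_subset_interior Nat.one_div_pos_of_nat hx)
      (fun x hx y hy => he x (hsub n hx) y (hsub n hy))
  have hmono : Monotone fun n : ℕ => erosion T (1 / (n + 1)) := fun m n h =>
    erosion_antitone T (Nat.one_div_le_one_div h)
  have h := lintegral_lintegral_iUnion_le (μ := volume) hmono
    (F := fun q : Space d × Space d => ‖φ q.1 - φ q.2‖ₑ ^ 2) (by rwa [← hr]) key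
  rwa [← hr] at h

theorem eLpNorm_two_sq {α F : Type*} [MeasurableSpace α] [NormedAddCommGroup F] (f : α → F)
    (μ : Measure α) : eLpNorm f 2 μ ^ 2 = ∫⁻ x, ‖f x‖ₑ ^ 2 ∂μ := by
  simpa using eLpNorm_nnreal_pow_eq_lintegral (f := f) (μ := μ) (p := 2) two_ne_zero

/-- The difference is the mean of `φ y - φ x` over `y`, and the square of a mean is at most the mean
of the squares. -/
theorem enorm_meanProj_sub_sq_le (hT : IsCompact T) (h0 : volume T ≠ 0)
    (hφ : MemLp φ 2 (volume.restrict T)) (x : Space d) :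
    ‖meanProj T φ - φ x‖ₑ ^ 2 ≤ (volume T)⁻¹ * ∫⁻ y in T, ‖φ x - φ y‖ₑ ^ 2 := by
  have hf : volume T ≠ ⊤ := hT.measure_lt_top.ne
  have : Fact (volume T < ⊤) := ⟨hf.lt_top⟩
  have hr : volume.real T ≠ 0 := (ENNReal.toReal_ne_zero).2 ⟨h0, hf⟩
  have hi : Integrable φ (volume.restrict T) := hφ.integrable one_le_two
  have h1 : meanProj T φ - φ x = (volume.real T)⁻¹ * ∫ y in T, (φ y - φ x) := by
    rw [integral_sub hi (integrable_const _), setIntegral_const, meanProj, smul_eq_mul]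
    field_simp
  have h2 : ‖(volume.real T)⁻¹‖ₑ = (volume T)⁻¹ := by
    rw [enorm_inv hr, measureReal_def, Real.enorm_of_nonneg ENNReal.toReal_nonneg,
      ENNReal.ofReal_toReal hf]
  rw [h1, enorm_mul, h2, mul_pow]
  calc (volume T)⁻¹ ^ 2 * ‖∫ y in T, (φ y - φ x)‖ₑ ^ 2
      ≤ (volume T)⁻¹ ^ 2 * (∫⁻ y in T, ‖φ x - φ y‖ₑ) ^ 2 := by
        gcongr
        refine (enorm_integral_le_lintegral_enorm _).trans (le_of_eq ?_)
        exact lintegral_congr fun y => enorm_sub_rev _ _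
    _ ≤ (volume T)⁻¹ ^ 2 * (volume T * ∫⁻ y in T, ‖φ x - φ y‖ₑ ^ 2) := by
        gcongr
        have hm : AEMeasurable (fun y => ‖φ x - φ y‖ₑ) (volume.restrict T) :=
          (aestronglyMeasurable_const.sub hφ.1).enorm
        refine (lintegral_sq_le hm).trans ?_
        rw [Measure.restrict_apply_univ]
    _ = _ := by
        rw [sq, mul_assoc, ← mul_assoc (volume T)⁻¹ (volume T), ENNReal.inv_mul_cancel h0 hf,
          one_mul]

/-- Poincaré's inequality on a convex body, with the derivatives in directions `e i` in which
the differences of points of the body have coordinates bounded by one. -/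
theorem eLpNorm_meanProj_sub_sq_le {ι : Type*} [Fintype ι]
    (hT : IsCompact T) (hTc : Convex ℝ T) (hφ : MemLp φ 2 (volume.restrict T))
    (hg : IsWeakGradient T φ g) {e : ι → Space d}
    (he : ∀ x ∈ T, ∀ y ∈ T, ∃ a : ι → ℝ, (∀ i, |a i| ≤ 1) ∧ x - y = ∑ i, a i • e i) :
    eLpNorm (fun x => meanProj T φ - φ x) 2 (volume.restrict T) ^ 2 ≤
      2 ^ d * Fintype.card ι *
        (∑ i, eLpNorm (fun x => inner ℝ (g x) (e i)) 2 (volume.restrict T)) ^ 2 := by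
  rcases eq_or_ne (volume T) 0 with h0 | h0
  · simp [Measure.restrict_eq_zero.2 h0]
  have hf : volume T ≠ ⊤ := hT.measure_lt_top.ne
  rw [eLpNorm_two_sq]
  calc ∫⁻ x in T, ‖meanProj T φ - φ x‖ₑ ^ 2
      ≤ ∫⁻ x in T, (volume T)⁻¹ * ∫⁻ y in T, ‖φ x - φ y‖ₑ ^ 2 :=
        lintegral_mono fun x => enorm_meanProj_sub_sq_le hT h0 hφ x
    _ = (volume T)⁻¹ * ∫⁻ x in T, ∫⁻ y in T, ‖φ x - φ y‖ₑ ^ 2 :=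
        lintegral_const_mul' _ _ (ENNReal.inv_ne_top.2 h0)
    _ ≤ (volume T)⁻¹ * (2 ^ d * volume T *
          (Fintype.card ι * ∑ i, ∫⁻ x in T, ‖inner ℝ (g x) (e i)‖ₑ ^ 2)) := by
        gcongr
        exact lintegral_lintegral_enorm_sub_sq_le hT hTc hφ hg he
    _ = ((volume T)⁻¹ * volume T) * (2 ^ d * Fintype.card ι *
          ∑ i, eLpNorm (fun x => inner ℝ (g x) (e i)) 2 (volume.restrict T) ^ 2) := by
        simp only [eLpNorm_two_sq]
        ring
    _ ≤ _ := by
        rw [ENNReal.inv_mul_cancel h0 hf, one_mul]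
        gcongr
        exact Finset.sum_sq_le_sq_sum_of_nonneg fun i _ => zero_le

theorem exists_weights_of_mem_simplex {p : Fin (d + 1) → Space d} {x : Space d}
    (hx : x ∈ simplex p) :
    ∃ w : Fin (d + 1) → ℝ, (∀ i, 0 ≤ w i) ∧ ∑ i, w i = 1 ∧ x = ∑ i, w i • p i := by
  have h : simplex p ⊆ Fintype.linearCombination ℝ p '' stdSimplex ℝ (Fin (d + 1)) := by
    refine convexHull_min ?_ ((convex_stdSimplex ℝ _).linear_image _)
    rintro _ ⟨i, rfl⟩
    exact ⟨Pi.single i 1, single_mem_stdSimplex ℝ i, by simp⟩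
  obtain ⟨w, hw, rfl⟩ := h hx
  exact ⟨w, hw.1, hw.2, by simp [Fintype.linearCombination_apply]⟩

theorem exists_coords_sub {k : ElementKind d} {p : Fin (d + 1) → Space d} {x y : Space d}
    (hx : x ∈ simplex p) (hy : y ∈ simplex p) :
    ∃ a : Fin d → ℝ, (∀ i, |a i| ≤ 1) ∧ x - y = ∑ i, a i • edge k p i := by
  obtain ⟨w, hw0, hw1, rfl⟩ := exists_weights_of_mem_simplex hx
  obtain ⟨w', hw0', hw1', rfl⟩ := exists_weights_of_mem_simplex hy
  cases k with
  | triangle =>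
    simp only [Fin.forall_fin_succ, Fin.sum_univ_succ, Fin.isValue] at hw0 hw1 hw0' hw1' ⊢
    simp at hw0 hw1 hw0' hw1'
    refine ⟨![w 1 - w' 1, w 2 - w' 2], ⟨?_, ?_, by simp⟩, ?_⟩
    · simp only [Matrix.cons_val_zero, abs_le]; constructor <;> linarith
    · simp [abs_le]; constructor <;> linarith
    · have e : w 0 = 1 - w 1 - w 2 := by linarith
      have e' : w' 0 = 1 - w' 1 - w' 2 := by linarith
      simp [edge, e, e']
      module
  | tetI =>
    simp only [Fin.forall_fin_succ, Fin.sum_univ_succ, Fin.isValue] at hw0 hw1 hw0' hw1' ⊢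
    simp at hw0 hw1 hw0' hw1'
    refine ⟨![w 1 - w' 1, w 2 - w' 2, w 3 - w' 3], ⟨?_, ?_, ?_, by simp⟩, ?_⟩
    · simp [abs_le]; constructor <;> linarith
    · simp [abs_le]; constructor <;> linarith
    · simp [abs_le]; constructor <;> linarith
    · have e : w 0 = 1 - w 1 - w 2 - w 3 := by linarith
      have e' : w' 0 = 1 - w' 1 - w' 2 - w' 3 := by linarith
      simp [edge, e, e']
      module
  | tetII =>
    simp only [Fin.forall_fin_succ, Fin.sum_univ_succ, Fin.isValue] at hw0 hw1 hw0' hw1' ⊢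
    simp at hw0 hw1 hw0' hw1'
    -- In type (ii), `p 2 - p 0` is the sum of the first two edge vectors, so the first coordinate
    -- collects the weights of both `p 1` and `p 2`; it still lies in `[0, 1]` for each point.
    refine ⟨![w 1 + w 2 - (w' 1 + w' 2), w 2 - w' 2, w 3 - w' 3], ⟨?_, ?_, ?_, by simp⟩, ?_⟩
    · simp [abs_le]; constructor <;> linarith
    · simp [abs_le]; constructor <;> linarith
    · simp [abs_le]; constructor <;> linarith
    · have e : w 0 = 1 - w 1 - w 2 - w 3 := by linarith
      have e' : w' 0 = 1 - w' 1 - w' 2 - w' 3 := by linarith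
      simp [edge, e, e']
      module

theorem edgeLength_mul_eLpNorm {k : ElementKind d} {p : Fin (d + 1) → Space d} (i : Fin d)
    (g : Space d → Space d) (μ : Measure (Space d)) :
    ENNReal.ofReal (edgeLength k p i) * eLpNorm (fun x => inner ℝ (edgeDir k p i) (g x)) 2 μ =
      eLpNorm (fun x => inner ℝ (g x) (edge k p i)) 2 μ := by
  have h : edgeLength k p i • edgeDir k p i = edge k p i := by
    rcases eq_or_ne (edge k p i) 0 with h | h
    -- For a zero edge vector both sides vanish, whatever the default value of the inverse.
    · simp [edgeDir, h]
    · rw [edgeDir, smul_inv_smul₀]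
      exact norm_ne_zero_iff.2 h
  have h0 : 0 ≤ edgeLength k p i := norm_nonneg _
  rw [← Real.enorm_of_nonneg h0, ← eLpNorm_const_smul]
  congr 1
  ext x
  rw [Pi.smul_apply, smul_eq_mul, ← real_inner_smul_left, h, real_inner_comm]

/-- The left side is `8` for triangles and `24` for tetrahedra. -/
theorem ElementKind.two_pow_mul_card_le (k : ElementKind d) :
    (2 ^ d * Fintype.card (Fin d) : ℝ≥0∞) ≤ ENNReal.ofReal 5 ^ 2 := by
  rw [ENNReal.ofReal_ofNat]
  cases k <;> norm_num

theorem meanEstimate_of_memH1 (k : ElementKind d) (p : Fin (d + 1) → Space d)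
    (hφ : MemH1 (simplex p) φ) : MeanEstimate 5 k p φ := by
  intro g hg
  simp only [edgeLength_mul_eLpNorm]
  rw [← ENNReal.pow_le_pow_left_iff two_ne_zero, mul_pow]
  refine (eLpNorm_meanProj_sub_sq_le (T := simplex p) ((finite_range p).isCompact_convexHull ℝ)
    (convex_convexHull ℝ _) hφ.1 hg fun x hx y hy => exists_coords_sub (k := k) hx hy).trans ?_
  refine mul_le_mul_left ?_ _
  exact k.two_pow_mul_card_le

end

/-! ### Affine invariance of `H¹` -/

section

variable {d : ℕ}

/-- An affine equivalence multiplies Lebesgue measure by a constant. -/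
theorem exists_map_volume_eq_smul (Φ : Space d ≃ᴬ[ℝ] Space d) :
    ∃ c : ℝ≥0∞, c ≠ 0 ∧ c ≠ ⊤ ∧ (volume : Measure (Space d)).map Φ = c • volume := by
  have hdet : LinearMap.det (Φ.toAffineEquiv.linear : Space d →ₗ[ℝ] Space d) ≠ 0 :=
    (LinearEquiv.isUnit_det' Φ.toAffineEquiv.linear).ne_zero
  refine ⟨ENNReal.ofReal |(LinearMap.det (Φ.toAffineEquiv.linear : Space d →ₗ[ℝ] Space d))⁻¹|,
    ?_, ENNReal.ofReal_ne_top, ?_⟩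
  · rw [Ne, ENNReal.ofReal_eq_zero, not_le]
    positivity
  · have h1 := Measure.map_linearMap_addHaar_eq_smul_addHaar (volume : Measure (Space d)) hdet
    have h2 : ⇑Φ = (fun x => x + Φ 0) ∘ (Φ.toAffineEquiv.linear : Space d →ₗ[ℝ] Space d) := by
      ext1 x
      have := Φ.toAffineEquiv.map_vadd 0 x
      simpa using this
    rw [h2, ← Measure.map_map (measurable_add_const _)
      (LinearMap.continuous_of_finiteDimensional _).measurable, h1, Measure.map_smul,
      map_add_right_eq_self]

theorem exists_map_restrict_eq_smul (Φ : Space d ≃ᴬ[ℝ] Space d) :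
    ∃ c : ℝ≥0∞, c ≠ 0 ∧ c ≠ ⊤ ∧ ∀ T : Set (Space d),
      (volume.restrict (Φ ⁻¹' T)).map Φ.toHomeomorph.toMeasurableEquiv =
        c • volume.restrict T := by
  obtain ⟨c, h0, h1, h⟩ := exists_map_volume_eq_smul Φ
  refine ⟨c, h0, h1, fun T => ?_⟩
  rw [← Measure.restrict_smul, ← h]
  exact (Φ.toHomeomorph.toMeasurableEquiv.restrict_map volume T).symm

variable {T : Set (Space d)}

theorem memLp_of_comp {F : Type*} [NormedAddCommGroup F] (Φ : Space d ≃ᴬ[ℝ] Space d)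
    {f : Space d → F} (hf : MemLp (f ∘ Φ) 2 (volume.restrict (Φ ⁻¹' T))) :
    MemLp f 2 (volume.restrict T) := by
  obtain ⟨c, h0, h1, h⟩ := exists_map_restrict_eq_smul Φ
  have hm : MemLp f 2 (c • volume.restrict T) := by
    rw [← h T]
    exact (Φ.toHomeomorph.toMeasurableEquiv.memLp_map_measure_iff).2 hf
  refine hm.of_measure_le_smul (ENNReal.inv_ne_top.2 h0) (le_of_eq ?_)
  rw [smul_smul, ENNReal.inv_mul_cancel h0 h1, one_smul]

theorem exists_mul_setIntegral_eq (Φ : Space d ≃ᴬ[ℝ] Space d) :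
    ∃ c : ℝ, c ≠ 0 ∧ ∀ (T : Set (Space d)) (f : Space d → ℝ),
      c * ∫ x in T, f x = ∫ x in Φ ⁻¹' T, f (Φ x) := by
  obtain ⟨c, h0, h1, h⟩ := exists_map_restrict_eq_smul Φ
  refine ⟨c.toReal, ENNReal.toReal_ne_zero.2 ⟨h0, h1⟩, fun T f => ?_⟩
  rw [← smul_eq_mul, ← integral_smul_measure, ← h T, integral_map_equiv]
  rfl

/-- The chain rule for weak gradients under affine equivalences. -/
theorem IsWeakGradient.comp_symm (Φ : Space d ≃ᴬ[ℝ] Space d) {φ : Space d → ℝ}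
    {g : Space d → Space d} (hg : IsWeakGradient (Φ ⁻¹' T) φ g) :
    IsWeakGradient T (φ ∘ Φ.symm) fun x =>
      ContinuousLinearMap.adjoint
        (Φ.symm.toContinuousAffineMap.contLinear : Space d →L[ℝ] Space d) (g (Φ.symm x)) := by
  set B : Space d →L[ℝ] Space d := Φ.symm.toContinuousAffineMap.contLinear with hB
  refine ⟨memLp_of_comp Φ ?_, fun ψ hψ hψc hψT v => ?_⟩
  · have h := (ContinuousLinearMap.adjoint B).comp_memLp' hg.1
    simpa [Function.comp_def] using h
  · obtain ⟨c, hc, hint⟩ := exists_mul_setIntegral_eq Φ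
    have hs : tsupport (ψ ∘ Φ) = Φ ⁻¹' tsupport ψ := tsupport_comp_eq_preimage ψ Φ.toHomeomorph
    have hi : Φ ⁻¹' interior T = interior (Φ ⁻¹' T) := Φ.toHomeomorph.preimage_interior T
    -- Testing in the direction `B v`, with `B` the linear part of the inverse, makes the derivative
    -- of `ψ ∘ Φ` equal to that of `ψ` along `v`; the Jacobian `c` then cancels from both sides.
    have h := hg.2 (ψ ∘ Φ) (hψ.comp Φ.toContinuousAffineMap.contDiff)
      (hψc.comp_homeomorph Φ.toHomeomorph) (by rw [hs, ← hi]; exact preimage_mono hψT) (B v)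
    have hd : ∀ x, fderiv ℝ (ψ ∘ Φ) x (B v) = fderiv ℝ ψ (Φ x) v := fun x => by
      have hΦ : HasFDerivAt Φ Φ.toContinuousAffineMap.contLinear x :=
        Φ.toContinuousAffineMap.hasFDerivAt
      rw [fderiv_comp x (hψ.differentiable (by simp) _) hΦ.differentiableAt, hΦ.fderiv,
        ContinuousLinearMap.comp_apply]
      congr 1
      exact Φ.toAffineEquiv.linear.apply_symm_apply v
    simp only [hd] at h
    apply mul_left_cancel₀ hc
    rw [mul_neg, hint, hint]
    simpa [ContinuousLinearMap.adjoint_inner_left] using h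

theorem MemH1.comp_symm (Φ : Space d ≃ᴬ[ℝ] Space d) {φ : Space d → ℝ}
    (hφ : MemH1 (Φ ⁻¹' T) φ) : MemH1 T (φ ∘ Φ.symm) := by
  obtain ⟨h, g, hg⟩ := hφ
  refine ⟨memLp_of_comp Φ ?_, _, hg.comp_symm Φ⟩
  convert h
  ext x
  simp

theorem preimage_simplex_eq (Φ : Space d ≃ᵃ[ℝ] Space d) {p q : Fin (d + 1) → Space d}
    (h : ∀ i, Φ (q i) = p i) : Φ ⁻¹' simplex p = simplex q := by
  have h1 : Φ '' simplex q = simplex p := by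
    have h2 := (Φ : Space d →ᵃ[ℝ] Space d).image_convexHull (range q)
    rw [← range_comp] at h2
    have h3 : p = ⇑(Φ : Space d →ᵃ[ℝ] Space d) ∘ q := funext fun i => (h i).symm
    rw [simplex, simplex, h3, ← h2]
    rfl
  rw [← h1, preimage_image_eq _ Φ.injective]

end

end AnisoElement

theorem mainTheorem9 :
    ∃ c : ℝ, 0 < c ∧
      ∀ (d : ℕ) (k : AnisoElement.ElementKind d)
        (p : Fin (d + 1) → AnisoElement.Space d),
        AffineIndependent ℝ p → AnisoElement.EdgeCondition k p →
        -- functions transported from the reference element by the affine map `Φ`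
        (∀ Φ : AnisoElement.Space d ≃ᵃ[ℝ] AnisoElement.Space d,
          (∀ i, Φ (AnisoElement.refVertex k i) = p i) →
          ∀ φhat : AnisoElement.Space d → ℝ,
            AnisoElement.MemH1 (AnisoElement.simplex (AnisoElement.refVertex k)) φhat →
            AnisoElement.MemH1 (AnisoElement.simplex p) (φhat ∘ Φ.symm) ∧
              AnisoElement.MeanEstimate c k p (φhat ∘ Φ.symm)) ∧
        -- arbitrary functions in `H¹` of the element
        (∀ φ : AnisoElement.Space d → ℝ,
          AnisoElement.MemH1 (AnisoElement.simplex p) φ →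
            AnisoElement.MeanEstimate c k p φ) := by
  refine ⟨5, by norm_num, fun d k p _ _ => ⟨fun Φ hΦ φhat hφ => ?_,
    fun φ hφ => AnisoElement.meanEstimate_of_memH1 k p hφ⟩⟩
  have h := AnisoElement.MemH1.comp_symm (T := AnisoElement.simplex p)
    (AffineEquiv.toContinuousAffineEquiv Φ) (φ := φhat) (by
      change AnisoElement.MemH1 (Φ ⁻¹' AnisoElement.simplex p) φhat
      rwa [AnisoElement.preimage_simplex_eq Φ hΦ])
  exact ⟨h, AnisoElement.meanEstimate_of_memH1 k p h⟩
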